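/- Let $d\ge 1$, let $|\cdot|$ be the Euclidean norm on $\mathbb{Z}^d$, and put $[a-b]=\min(|a-b|,|a+b|)$ for $a,b\in\mathbb{Z}^d$ (a pseudo-metric on $\mathbb{Z}^d$). For $\Delta\in\mathbb{N}\cup\{\infty\}$ (where $0\in\mathbb{N}$), consider the equivalence relation on $\mathbb{Z}^d$ generated by the pre-equivalence $$a\sim b\iff |a|=|b|\ \text{ and }\ [a-b]\le\Delta ,$$ let $[a]_\Delta$ denote the equivalence class of $a$, and let $$d_\Delta=\sup\{[a-b] : a,b\in\mathbb{Z}^d,\ [a]_\Delta=[b]_\Delta\}\in[0,\infty].$$ Then there is a constant $C>0$, depending only on $d$, such that for every $\Delta\in\mathbb{N}\cup\{\infty\}$ $$d_\Delta\le C\,\Delta^{\frac{(d+1)!}{2}},$$ where the right-hand side is $\infty$ if $\Delta=\infty$. Moreover, if $\Delta<\infty$, the supremum defining $d_\Delta$ is a maximum. -/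

import Mathlib

open scoped ENNReal Nat

noncomputable section

/-- The Euclidean norm `|a|` of a lattice point `a ∈ ℤ^d`. -/
def latticeNorm {d : ℕ} (a : Fin d → ℤ) : ℝ :=
  ‖(WithLp.toLp 2 (fun i => (a i : ℝ)) : EuclideanSpace ℝ (Fin d))‖

/-- The pseudo-metric `[a - b] = min (|a - b|, |a + b|)` on `ℤ^d`. -/
def pseudoDist {d : ℕ} (a b : Fin d → ℤ) : ℝ :=
  min (latticeNorm (a - b)) (latticeNorm (a + b))

/-- The pre-equivalence `a ∼ b`: `|a| = |b|` and `[a - b] ≤ Δ`, for `Δ ∈ ℕ ∪ {∞}`.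
The nonnegative real `[a - b]` is compared with `Δ` inside `[0, ∞]`. -/
def PreEquiv {d : ℕ} (Δ : ℕ∞) (a b : Fin d → ℤ) : Prop :=
  latticeNorm a = latticeNorm b ∧ ENNReal.ofReal (pseudoDist a b) ≤ (Δ : ℝ≥0∞)

/-- The block `[a]_Δ`: the class of `a` for the equivalence relation generated by `PreEquiv Δ`. -/
def block {d : ℕ} (Δ : ℕ∞) (a : Fin d → ℤ) : Set (Fin d → ℤ) :=
  {b | Relation.EqvGen (PreEquiv Δ) a b}

/-- All values `[a - b]`, as elements of `[0, ∞]`, for `a`, `b` in a common block. -/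
def blockDistances (d : ℕ) (Δ : ℕ∞) : Set ℝ≥0∞ :=
  {t | ∃ a b : Fin d → ℤ, block Δ a = block Δ b ∧ t = ENNReal.ofReal (pseudoDist a b)}

/-- The maximal block diameter `d_Δ`, as the supremum of `[a - b]` over all pairs with
`[a]_Δ = [b]_Δ`; it is taken in `[0, ∞]`, so no boundedness is presupposed. -/
def blockDiameter (d : ℕ) (Δ : ℕ∞) : ℝ≥0∞ :=
  sSup (blockDistances d Δ)

end

/-! Up to sign, a block is what can be reached from `a` by steps of length at most `Δ` on one
sphere. Given `k` reachable independent displacements of length at most `r ≥ 1`, the sphere cut by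
`a +` their span has diameter `O(r^(k+1))`: the Gram determinant is a positive integer, so Cramer's
rule loses nothing in its denominator (`norm_le_of_mem_span_sphere`). Either all chains stay in this
section, or the first exit gives a further independent displacement of length `O(r^(k+1)) + Δ`.

A line meets the sphere in at most two points, so two displacements cost only `2 * Δ`. From there
`r_(k+1) ~ r_k^(k+1)` yields `r_k ~ Δ^(k!/2)`. In dimension `d` there are no `d + 1` independent
vectors, so the growth stops at exponent `(d+1)!/2`. -/

/-- If `k` linearly independent vectors with integral Gram matrix, of length at most `r`, join `a` to
points of the sphere through `a`, then the section of that sphere by `a +` their span is bounded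
polynomially in `r`. -/
theorem norm_le_of_mem_span_sphere {E : Type*} [NormedAddCommGroup E] [InnerProductSpace ℝ E]
    {k : ℕ} {u : Fin k → E} (hu : LinearIndependent ℝ u)
    (hint : ∀ i j, ∃ z : ℤ, inner ℝ (u i) (u j) = z) {r : ℝ} (hr : ∀ i, ‖u i‖ ≤ r)
    {a w : E} (ha : ∀ i, ‖a + u i‖ = ‖a‖) (hw : w ∈ Submodule.span ℝ (Set.range u))
    (haw : ‖a + w‖ = ‖a‖) :
    ‖w‖ ^ 2 ≤ 2 * (k * k ! * r ^ (2 * k + 2)) := by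
  set G : Matrix (Fin k) (Fin k) ℝ := Matrix.gram ℝ u with hG
  set h : Fin k → ℝ := fun i => inner ℝ (u i) a with hh
  have hnorm : ∀ v : E, ‖a + v‖ = ‖a‖ → inner ℝ v a = -(‖v‖ ^ 2 / 2) := by
    intro v hv
    have := norm_add_sq_real a v
    rw [hv, real_inner_comm] at this
    linarith
  have hGb : ∀ i j, |G i j| ≤ r ^ 2 := by
    intro i j
    have h1 := abs_real_inner_le_norm (u i) (u j)
    have h0 := norm_nonneg (u i)
    have h0' := norm_nonneg (u j)
    have : G i j = inner ℝ (u i) (u j) := rfl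
    rw [this]
    nlinarith [hr i, hr j]
  have hhb : ∀ i, |h i| ≤ r ^ 2 / 2 := by
    intro i
    have h0 := norm_nonneg (u i)
    have : h i = -(‖u i‖ ^ 2 / 2) := hnorm _ (ha i)
    rw [this, abs_neg, abs_of_nonneg (by positivity)]
    nlinarith [hr i]
  have hdet : 1 ≤ G.det := by
    have hpos : 0 < G.det := (Matrix.posDef_gram_of_linearIndependent hu).det_pos
    choose z hz using hint
    have hmap : G = (Matrix.of z).map (Int.castRingHom ℝ) := by
      ext i j
      exact hz i j
    rw [hmap, ← RingHom.mapMatrix_apply, ← RingHom.map_det] at hpos ⊢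
    simp only [eq_intCast] at hpos ⊢
    exact_mod_cast hpos
  set x : Fin k → ℝ := fun i => G.cramer h i / G.det with hx
  have hGx : G.mulVec x = h := by
    have : x = G.det⁻¹ • G.cramer h := by
      ext i; simp [hx, div_eq_inv_mul]
    rw [this, Matrix.mulVec_smul, Matrix.mulVec_cramer, smul_smul,
      inv_mul_cancel₀ (by positivity), one_smul]
  have hxb : ∀ i, |x i| ≤ k ! * r ^ (2 * k) := by
    intro i
    rw [hx]
    simp only [abs_div, abs_of_pos (lt_of_lt_of_le one_pos hdet)]
    refine (div_le_self (abs_nonneg _) hdet).trans ?_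
    rw [Matrix.cramer_apply]
    have := Matrix.det_le (A := G.updateCol i h) (abv := AbsoluteValue.abs) (x := r ^ 2) (by
      intro p q
      simp only [AbsoluteValue.abs_apply, Matrix.updateCol_apply]
      split_ifs
      · exact (hhb p).trans (by nlinarith [sq_nonneg r])
      · exact hGb p q)
    simpa [pow_mul] using this
  -- `c` is the orthogonal projection of `a` onto the span, so the section of the sphere has centre
  -- `a - c` and radius `‖c‖`.
  set c : E := ∑ i, x i • u i with hc
  have hcu : ∀ v ∈ Submodule.span ℝ (Set.range u), inner ℝ v c = inner ℝ v a := by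
    intro v hv
    induction hv using Submodule.span_induction with
    | mem v hv =>
      obtain ⟨i, rfl⟩ := hv
      have := congrFun hGx i
      simp only [hc, inner_sum, inner_smul_right]
      rw [← show h i = inner ℝ (u i) a from rfl, ← this]
      simp only [Matrix.mulVec, dotProduct]
      exact Finset.sum_congr rfl fun j _ => mul_comm _ _
    | zero => simp
    | add v v' _ _ h1 h2 => simp [inner_add_left, h1, h2]
    | smul t v _ h1 => simp [inner_smul_left, h1]
  have hcc : ‖c‖ ^ 2 ≤ k * k ! * r ^ (2 * k + 2) / 2 := by
    have hcm : c ∈ Submodule.span ℝ (Set.range u) :=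
      Submodule.sum_mem _ fun i _ => Submodule.smul_mem _ _ (Submodule.subset_span ⟨i, rfl⟩)
    rw [← real_inner_self_eq_norm_sq, hcu c hcm, hc, sum_inner]
    calc ∑ i, inner ℝ (x i • u i) a ≤ ∑ i : Fin k, (k ! * r ^ (2 * k)) * (r ^ 2 / 2) := by
          refine Finset.sum_le_sum fun i _ => ?_
          rw [real_inner_smul_left]
          refine (le_abs_self _).trans ?_
          rw [abs_mul]
          exact mul_le_mul (hxb i) (hhb i) (abs_nonneg _) ((abs_nonneg _).trans (hxb i))
      _ = k * k ! * r ^ (2 * k + 2) / 2 := by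
          simp; ring
  have hwc : ‖w‖ ≤ 2 * ‖c‖ := by
    have h1 := hnorm w haw
    rw [← hcu w hw] at h1
    have h2 := abs_real_inner_le_norm w c
    rw [h1, abs_neg, abs_of_nonneg (by positivity)] at h2
    rcases (norm_nonneg w).eq_or_lt with h3 | h3
    · rw [← h3]; positivity
    · nlinarith
  nlinarith [norm_nonneg w, norm_nonneg c]

/-! ### Growth of independent displacements along chains. -/

theorem exists_exit {α V : Type*} [AddCommGroup V] [Module ℝ V] {R : α → α → Prop} {f : α → V}
    {X : Submodule ℝ V} {a b : α} (h : Relation.ReflTransGen R a b) (hb : f b - f a ∉ X) :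
    ∃ c c', Relation.ReflTransGen R a c ∧ R c c' ∧ f c - f a ∈ X ∧ f c' - f a ∉ X := by
  induction h with
  | refl => simp at hb
  | @tail b c hab hbc ih =>
    by_cases h1 : f b - f a ∈ X
    · exact ⟨b, c, hab, hbc, h1, hb⟩
    · exact ih h1

section Chains

open Relation

theorem norm_eq_of_chain {α E : Type*} [NormedAddCommGroup E] {R : α → α → Prop} {f : α → E}
    (hR : ∀ x y, R x y → ‖f x‖ = ‖f y‖) {a b : α} (h : ReflTransGen R a b) : ‖f b‖ = ‖f a‖ := by
  induction h with
  | refl => rfl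
  | tail _ h ih => rw [← hR _ _ h, ih]

variable {α E : Type*} [NormedAddCommGroup E] [InnerProductSpace ℝ E]

/-- From `a` one reaches, along `R`-chains, `k` points whose differences to `a` are linearly
independent and have length at most `r`. -/
def HasIndepDisplacements (R : α → α → Prop) (f : α → E) (a : α) (k : ℕ) (r : ℝ) : Prop :=
  ∃ p : Fin k → α, (∀ i, ReflTransGen R a (p i)) ∧
    LinearIndependent ℝ (fun i => f (p i) - f a) ∧ ∀ i, ‖f (p i) - f a‖ ≤ r

variable {R : α → α → Prop} {f : α → E} {Δ : ℝ} {a : α}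

theorem hasIndepDisplacements_succ_or_bounded (hR : ∀ x y, R x y → ‖f x - f y‖ ≤ Δ) {k : ℕ}
    {r B : ℝ} {p : Fin k → α} (hp : ∀ i, ReflTransGen R a (p i))
    (hli : LinearIndependent ℝ (fun i => f (p i) - f a)) (hr : ∀ i, ‖f (p i) - f a‖ ≤ r)
    (hB : ∀ b, ReflTransGen R a b →
      f b - f a ∈ Submodule.span ℝ (Set.range fun i => f (p i) - f a) → ‖f b - f a‖ ≤ B) :
    HasIndepDisplacements R f a (k + 1) (max r (B + Δ)) ∨
      ∀ b, ReflTransGen R a b → ‖f b - f a‖ ≤ B := by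
  by_cases hall : ∀ b, ReflTransGen R a b →
      f b - f a ∈ Submodule.span ℝ (Set.range fun i => f (p i) - f a)
  · exact Or.inr fun b hb => hB b hb (hall b hb)
  push Not at hall
  obtain ⟨b, hab, hb⟩ := hall
  obtain ⟨c, q, hac, hcq, hc, hq⟩ := exists_exit hab hb
  have haq : ReflTransGen R a q := hac.tail hcq
  have hqB : ‖f q - f a‖ ≤ B + Δ := by
    have h1 := hR _ _ hcq
    rw [norm_sub_rev] at h1
    have h2 := norm_add_le (f c - f a) (f q - f c)
    rw [sub_add_sub_cancel'] at h2
    linarith [hB c hac hc]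
  have hsn : (fun i => f ((Fin.snoc p q : Fin (k + 1) → α) i) - f a) =
      Fin.snoc (α := fun _ => E) (fun i => f (p i) - f a) (f q - f a) := by
    funext i
    refine Fin.lastCases ?_ (fun i => ?_) i <;> simp
  have hli' : LinearIndependent ℝ (fun i => f ((Fin.snoc p q : Fin (k + 1) → α) i) - f a) := by
    rw [hsn]
    exact linearIndependent_finSnoc.2 ⟨hli, hq⟩
  refine Or.inl ⟨Fin.snoc p q, fun i => ?_, hli', fun i => ?_⟩
  · refine Fin.lastCases ?_ (fun i => ?_) i
    · simpa using haq
    · simpa using hp i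
  · refine Fin.lastCases ?_ (fun i => ?_) i
    · simpa using Or.inr hqB
    · simpa using Or.inl (hr i)

/-- A line through `a` meets the sphere through `a` in at most one further point. -/
theorem norm_le_of_mem_span_singleton_sphere {x u w : E} (hu : ‖x + u‖ = ‖x‖)
    (hw : w ∈ Submodule.span ℝ {u}) (hxw : ‖x + w‖ = ‖x‖) : ‖w‖ ≤ ‖u‖ := by
  obtain ⟨t, rfl⟩ := Submodule.mem_span_singleton.1 hw
  have h1 := norm_add_sq_real x u
  have h2 := norm_add_sq_real x (t • u)
  rw [hu] at h1
  rw [hxw, inner_smul_right, norm_smul, mul_pow, Real.norm_eq_abs, sq_abs] at h2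
  have h3 : t * (t - 1) * ‖u‖ ^ 2 = 0 := by linear_combination t * h1 - h2
  rcases mul_eq_zero.1 h3 with h | h
  · rcases mul_eq_zero.1 h with h | h
    · simp [h]
    · simp [sub_eq_zero.1 h]
  · simp [pow_eq_zero_iff] at h
    simp [h]

/-- Starting the induction at two displacements is what halves the exponent: the general sphere
bound at `k = 1` would already give order `Δ ^ 2`. -/
theorem hasIndepDisplacements_two_or_bounded (hΔ : 0 ≤ Δ)
    (hR : ∀ x y, R x y → ‖f x‖ = ‖f y‖) (hR' : ∀ x y, R x y → ‖f x - f y‖ ≤ Δ) (a : α) :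
    HasIndepDisplacements R f a 2 (2 * Δ) ∨ ∀ b, ReflTransGen R a b → ‖f b - f a‖ ≤ 2 * Δ := by
  rcases hasIndepDisplacements_succ_or_bounded (a := a) hR' (k := 0) (r := 0) (B := 0)
      (p := Fin.elim0) (fun i => i.elim0) linearIndependent_empty_type (fun i => i.elim0)
      (fun b _ h => by simpa using h) with h | h
  · rw [zero_add Δ, max_eq_right hΔ] at h
    obtain ⟨p, hp, hli, hr⟩ := h
    rcases hasIndepDisplacements_succ_or_bounded hR' (B := Δ) hp hli hr (fun b hb h => by
      refine (norm_le_of_mem_span_singleton_sphere (x := f a) (u := f (p 0) - f a) ?_ ?_ ?_).trans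
        (hr 0)
      · simpa using norm_eq_of_chain hR (hp 0)
      · simpa [Set.range_unique] using h
      · simpa using norm_eq_of_chain hR hb) with h | h
    · rw [max_eq_right (by linarith), ← two_mul Δ] at h
      exact Or.inl h
    · exact Or.inr fun b hb => (h b hb).trans (by linarith)
  · exact Or.inr fun b hb => (h b hb).trans (by linarith)

theorem factorial_succ_div_two {k : ℕ} (hk : 2 ≤ k) : (k + 1)! / 2 = k ! / 2 * (k + 1) := by
  obtain ⟨m, hm⟩ := Nat.dvd_factorial two_pos hk
  rw [Nat.factorial_succ, hm, mul_left_comm, Nat.mul_div_cancel_left _ two_pos,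
    Nat.mul_div_cancel_left _ two_pos, mul_comm]

/-- The radius constants in the growth of the number of independent displacements. -/
theorem exists_hasIndepDisplacements_or_bounded (k : ℕ) (hk : 2 ≤ k) :
    ∃ C : ℝ, 1 ≤ C ∧ ∀ {α E : Type} [NormedAddCommGroup E] [InnerProductSpace ℝ E]
      (R : α → α → Prop) (f : α → E) (Δ : ℝ), 1 ≤ Δ →
      (∀ x y, R x y → ‖f x‖ = ‖f y‖) → (∀ x y, R x y → ‖f x - f y‖ ≤ Δ) →
      (∀ x y z, ∃ n : ℤ, inner ℝ (f x - f z) (f y - f z) = n) → ∀ a,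
      HasIndepDisplacements R f a k (C * Δ ^ (k ! / 2)) ∨
        ∀ b, ReflTransGen R a b → ‖f b - f a‖ ≤ C * Δ ^ (k ! / 2) := by
  induction k, hk using Nat.le_induction with
  | base =>
    refine ⟨2, by norm_num, fun R f Δ hΔ hR hR' _ a => ?_⟩
    simpa using hasIndepDisplacements_two_or_bounded (by linarith) hR hR' a
  | succ k hk ih =>
    obtain ⟨C, hC, ih⟩ := ih
    have hK : (1 : ℝ) ≤ k * k ! := by
      exact_mod_cast Nat.mul_pos (by omega) (Nat.factorial_pos k)
    refine ⟨2 * (k * k !) * C ^ (k + 1) + 1, ?_, fun R f Δ hΔ hR hR' hint a => ?_⟩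
    · have : 0 ≤ C ^ (k + 1) := by positivity
      nlinarith [mul_nonneg (zero_le_one.trans hK) this]
    set r := C * Δ ^ (k ! / 2) with hr
    have hr1 : 1 ≤ r := one_le_mul_of_one_le_of_one_le hC (one_le_pow₀ hΔ)
    have hrk : r ≤ r ^ (k + 1) := le_self_pow₀ hr1 (by omega)
    have hrB : r ^ (k + 1) ≤ 2 * (k * k !) * r ^ (k + 1) :=
      le_mul_of_one_le_left (by positivity) (by linarith)
    have hBΔ : 2 * (k * k !) * r ^ (k + 1) + Δ ≤
        (2 * (k * k !) * C ^ (k + 1) + 1) * Δ ^ ((k + 1)! / 2) := by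
      have h1 : r ^ (k + 1) = C ^ (k + 1) * Δ ^ ((k + 1)! / 2) := by
        rw [hr, mul_pow, ← pow_mul, factorial_succ_div_two hk]
      have h2 : Δ ≤ Δ ^ ((k + 1)! / 2) := by
        refine le_self_pow₀ hΔ (Nat.div_pos ?_ two_pos).ne'
        exact (by omega : 2 ≤ k + 1).trans (Nat.self_le_factorial _)
      rw [h1]
      linarith
    rcases ih R f Δ hΔ hR hR' hint a with ⟨p, hp, hli, hpr⟩ | h
    · rcases hasIndepDisplacements_succ_or_bounded hR' (B := 2 * (k * k !) * r ^ (k + 1)) hp hli hpr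
        (fun b hb h => by
          have h1 := norm_le_of_mem_span_sphere hli (fun i j => hint _ _ _) hpr (a := f a)
            (fun i => by simpa using norm_eq_of_chain hR (hp i)) h
            (by simpa using norm_eq_of_chain hR hb)
          refine abs_le_of_sq_le_sq' (h1.trans ?_) (by positivity) |>.2
          have h2 : 0 ≤ r ^ (2 * k + 2) := by positivity
          -- The sphere bound controls the square; since `2 * (k * k !) ≥ 1`, this factor may
          -- replace its square root.
          have h3 : (2 * (k * k ! : ℝ) * r ^ (k + 1)) ^ 2 =
            (2 * (k * k !)) * (2 * (k * k ! * r ^ (2 * k + 2))) := by ring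
          rw [h3]
          exact le_mul_of_one_le_left (by positivity) (by linarith)) with h | h
      · obtain ⟨p', hp', hli', hr'⟩ := h
        refine Or.inl ⟨p', hp', hli', fun i => (hr' i).trans (max_le ?_ hBΔ)⟩
        linarith
      · exact Or.inr fun b hb => (h b hb).trans (by linarith)
    · exact Or.inr fun b hb => (h b hb).trans (by linarith)

end Chains

/-! ### Application to the integer lattice. -/

section Lattice

open Relation

variable {d : ℕ}

/-- The inclusion of `ℤ^d` into Euclidean space. -/
def latticeToEuclidean (a : Fin d → ℤ) : EuclideanSpace ℝ (Fin d) :=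
  WithLp.toLp 2 fun i => (a i : ℝ)

theorem latticeNorm_eq (a : Fin d → ℤ) : latticeNorm a = ‖latticeToEuclidean a‖ := rfl

theorem latticeToEuclidean_sub (a b : Fin d → ℤ) :
    latticeToEuclidean (a - b) = latticeToEuclidean a - latticeToEuclidean b := by
  ext i; simp [latticeToEuclidean]

theorem latticeNorm_neg (a : Fin d → ℤ) : latticeNorm (-a) = latticeNorm a := by
  have : latticeToEuclidean (-a) = -latticeToEuclidean a := by
    ext i; simp [latticeToEuclidean]
  rw [latticeNorm_eq, this, norm_neg, latticeNorm_eq]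

theorem latticeNorm_sub_comm (a b : Fin d → ℤ) : latticeNorm (a - b) = latticeNorm (b - a) := by
  rw [← latticeNorm_neg, neg_sub]

theorem exists_int_inner_latticeToEuclidean (a b : Fin d → ℤ) :
    ∃ n : ℤ, inner ℝ (latticeToEuclidean a) (latticeToEuclidean b) = n :=
  ⟨∑ i, b i * a i, by simp [latticeToEuclidean, PiLp.inner_apply]⟩

theorem exists_nat_latticeNorm (a : Fin d → ℤ) : ∃ n : ℕ, latticeNorm a = √n := by
  obtain ⟨z, hz⟩ := exists_int_inner_latticeToEuclidean a a
  rw [real_inner_self_eq_norm_sq, ← latticeNorm_eq] at hz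
  have hz0 : 0 ≤ z := by
    have : (0 : ℝ) ≤ z := hz ▸ sq_nonneg _
    exact_mod_cast this
  lift z to ℕ using hz0
  refine ⟨z, ?_⟩
  rw [← Int.cast_natCast, ← hz, latticeNorm_eq, Real.sqrt_sq (norm_nonneg _)]

theorem exists_nat_pseudoDist (a b : Fin d → ℤ) : ∃ n : ℕ, pseudoDist a b = √n := by
  rcases min_choice (latticeNorm (a - b)) (latticeNorm (a + b)) with h | h
  · exact (exists_nat_latticeNorm (a - b)).imp fun n hn => h.trans hn
  · exact (exists_nat_latticeNorm (a + b)).imp fun n hn => h.trans hn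

/-- The pre-equivalence without the identification of `a` with `-a`. -/
def LatticeStep (Δ : ℝ) (a b : Fin d → ℤ) : Prop :=
  latticeNorm a = latticeNorm b ∧ latticeNorm (a - b) ≤ Δ

theorem LatticeStep.symm {Δ : ℝ} {a b : Fin d → ℤ} (h : LatticeStep Δ a b) : LatticeStep Δ b a :=
  ⟨h.1.symm, latticeNorm_sub_comm a b ▸ h.2⟩

theorem LatticeStep.neg {Δ : ℝ} {a b : Fin d → ℤ} (h : LatticeStep Δ a b) :
    LatticeStep Δ (-a) (-b) := by
  refine ⟨by simpa only [latticeNorm_neg] using h.1, ?_⟩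
  rw [neg_sub_neg, latticeNorm_sub_comm]
  exact h.2

theorem chain_symm {Δ : ℝ} {a b : Fin d → ℤ} (h : ReflTransGen (LatticeStep Δ) a b) :
    ReflTransGen (LatticeStep Δ) b a := by
  induction h with
  | refl => exact .refl
  | tail _ h ih => exact .head h.symm ih

theorem chain_neg {Δ : ℝ} {a b : Fin d → ℤ} (h : ReflTransGen (LatticeStep Δ) a b) :
    ReflTransGen (LatticeStep Δ) (-a) (-b) := by
  induction h with
  | refl => exact .refl
  | tail _ h ih => exact .tail ih h.neg

/-- Steps are invariant under negation, so all sign changes can be pushed to the end of the chain.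
-/
theorem chain_or_chain_neg_of_eqvGen {n : ℕ} {a b : Fin d → ℤ}
    (h : EqvGen (PreEquiv (n : ℕ∞)) a b) :
    ReflTransGen (LatticeStep n) a b ∨ ReflTransGen (LatticeStep n) a (-b) := by
  induction h with
  | rel a b h =>
    obtain ⟨h1, h2⟩ := h
    rw [ENat.toENNReal_coe, ← ENNReal.ofReal_natCast,
      ENNReal.ofReal_le_ofReal_iff n.cast_nonneg] at h2
    rcases min_le_iff.1 h2 with h2 | h2
    · exact Or.inl (.single ⟨h1, h2⟩)
    · exact Or.inr (.single ⟨by rw [latticeNorm_neg, h1], by rwa [sub_neg_eq_add]⟩)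
  | refl a => exact Or.inl .refl
  | symm a b _ ih =>
    rcases ih with h | h
    · exact Or.inl (chain_symm h)
    · exact Or.inr (by simpa using chain_neg (chain_symm h))
  | trans a b c _ _ ih1 ih2 =>
    rcases ih1 with h1 | h1 <;> rcases ih2 with h2 | h2
    · exact Or.inl (h1.trans h2)
    · exact Or.inr (h1.trans h2)
    · exact Or.inr (h1.trans (chain_neg h2))
    · exact Or.inl (by simpa using h1.trans (chain_neg h2))

theorem pseudoDist_le_of_eqvGen {n : ℕ} {B : ℝ} {a b : Fin d → ℤ}
    (hB : ∀ b, ReflTransGen (LatticeStep n) a b → latticeNorm (b - a) ≤ B)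
    (h : EqvGen (PreEquiv (n : ℕ∞)) a b) : pseudoDist a b ≤ B := by
  rcases chain_or_chain_neg_of_eqvGen h with h | h
  · exact (min_le_left _ _).trans (latticeNorm_sub_comm a b ▸ hB b h)
  · refine (min_le_right _ _).trans ?_
    have := hB _ h
    rwa [latticeNorm_sub_comm, sub_neg_eq_add] at this

theorem latticeNorm_zero : latticeNorm (0 : Fin d → ℤ) = 0 := by
  have h := latticeToEuclidean_sub (0 : Fin d → ℤ) 0
  rw [sub_self, sub_self] at h
  rw [latticeNorm_eq, h, norm_zero]

theorem eq_of_latticeNorm_sub_le_zero {a b : Fin d → ℤ} (h : latticeNorm (a - b) ≤ 0) : a = b := by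
  rw [latticeNorm_eq, norm_le_zero_iff, latticeToEuclidean_sub, sub_eq_zero] at h
  funext i
  have := congrArg (fun v : EuclideanSpace ℝ (Fin d) => v i) h
  simpa [latticeToEuclidean] using this

theorem exists_latticeNorm_le_of_chain (d : ℕ) :
    ∃ C : ℝ, 0 < C ∧ ∀ (n : ℕ) (a b : Fin d → ℤ), ReflTransGen (LatticeStep n) a b →
      latticeNorm (b - a) ≤ C * (n : ℝ) ^ ((((d + 1)! : ℕ) : ℝ) / 2) := by
  rcases d.eq_zero_or_pos with rfl | hd
  · refine ⟨1, one_pos, fun n a b _ => ?_⟩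
    rw [Subsingleton.elim b a, sub_self, latticeNorm_zero]
    positivity
  obtain ⟨C, hC, h⟩ := exists_hasIndepDisplacements_or_bounded (d + 1) (by omega)
  refine ⟨C, by linarith, fun n a b hab => ?_⟩
  -- The growth estimate needs `1 ≤ Δ`; for `Δ = 0` every step is trivial.
  rcases n.eq_zero_or_pos with rfl | hn
  · have : b = a := by
      induction hab with
      | refl => rfl
      | tail _ h ih =>
        exact (eq_of_latticeNorm_sub_le_zero (by simpa using h.2)).symm.trans ih
    rw [this, sub_self, latticeNorm_zero]
    positivity
  have hexp : (((d + 1)! : ℕ) : ℝ) / 2 = ((d + 1)! / 2 : ℕ) := by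
    rw [Nat.cast_div (Nat.dvd_factorial two_pos (by omega)) (by norm_num)]
    norm_num
  rw [hexp, Real.rpow_natCast, latticeNorm_eq, latticeToEuclidean_sub]
  rcases h (LatticeStep (d := d) n) latticeToEuclidean n (by exact_mod_cast hn) (fun _ _ h => h.1)
      (fun x y h => by rw [← latticeToEuclidean_sub]; exact h.2)
      (fun x y z => by
        rw [← latticeToEuclidean_sub, ← latticeToEuclidean_sub]
        exact exists_int_inner_latticeToEuclidean _ _) a with ⟨p, -, hli, -⟩ | h
  · simpa using hli.fintype_card_le_finrank
  · exact h b hab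

/-- Each distance is the square root of a natural number, and only finitely many of these lie below
a finite bound. -/
theorem finite_blockDistances {Δ : ℕ∞} {B : ℝ} (hB : blockDiameter d Δ ≤ ENNReal.ofReal B) :
    (blockDistances d Δ).Finite := by
  refine ((Set.finite_Iic ⌊B ^ 2⌋₊).image fun n : ℕ => ENNReal.ofReal √n).subset ?_
  rintro t ht
  have htB := (le_sSup ht).trans hB
  obtain ⟨a, b, -, rfl⟩ := ht
  obtain ⟨m, hm⟩ := exists_nat_pseudoDist a b
  rw [hm] at htB ⊢
  refine ⟨m, Nat.le_floor ?_, rfl⟩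
  rcases (Nat.cast_nonneg m : (0 : ℝ) ≤ m).eq_or_lt with h0 | h0
  · rw [← h0]; positivity
  · rw [ENNReal.ofReal_le_ofReal_iff' ] at htB
    rcases htB with h | h
    · exact (Real.sqrt_le_left ((Real.sqrt_nonneg _).trans h)).1 h
    · exact absurd h (Real.sqrt_pos.2 h0).not_ge

theorem isGreatest_blockDiameter {Δ : ℕ∞} {B : ℝ} (hB : blockDiameter d Δ ≤ ENNReal.ofReal B) :
    IsGreatest (blockDistances d Δ) (blockDiameter d Δ) :=
  ⟨Set.Nonempty.csSup_mem ⟨_, 0, 0, rfl, rfl⟩ (finite_blockDistances hB), fun _ => le_sSup⟩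

end Lattice

theorem proposition5p1 (d : ℕ) :
    ∃ C : ℝ, 0 < C ∧ ∀ Δ : ℕ∞,
      blockDiameter d Δ ≤ ENNReal.ofReal C * (Δ : ℝ≥0∞) ^ ((((d + 1)! : ℕ) : ℝ) / 2) ∧
      (Δ ≠ ⊤ → IsGreatest (blockDistances d Δ) (blockDiameter d Δ)) := by
  obtain ⟨C, hC, h⟩ := exists_latticeNorm_le_of_chain d
  have hexp : 0 < (((d + 1)! : ℕ) : ℝ) / 2 := by positivity
  refine ⟨C, hC, fun Δ => ?_⟩
  induction Δ using ENat.recTopCoe with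
  | top =>
    rw [ENat.toENNReal_top, ENNReal.top_rpow_of_pos hexp,
      ENNReal.mul_top (ENNReal.ofReal_pos.2 hC).ne']
    exact ⟨le_top, fun h => absurd rfl h⟩
  | coe n =>
    rw [ENat.toENNReal_coe, ← ENNReal.ofReal_natCast,
      ENNReal.ofReal_rpow_of_nonneg n.cast_nonneg hexp.le, ← ENNReal.ofReal_mul hC.le]
    have hB : blockDiameter d n ≤
        ENNReal.ofReal (C * (n : ℝ) ^ ((((d + 1)! : ℕ) : ℝ) / 2)) := by
      refine sSup_le ?_
      rintro _ ⟨a, b, hab, rfl⟩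
      have hb : b ∈ block (n : ℕ∞) a := hab ▸ Relation.EqvGen.refl b
      exact ENNReal.ofReal_le_ofReal (pseudoDist_le_of_eqvGen (h n a) hb)
    exact ⟨hB, fun _ => isGreatest_blockDiameter hB⟩
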